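/- Let $k$ be a field and let $\mathscr{Y}$ be the Young lattice: the poset of partitions, i.e. of weakly decreasing sequences $\mathbf{x}=(x_1\ge x_2\ge\cdots)$ of natural numbers with only finitely many nonzero entries (including $\mathbf{0}$), ordered by $\mathbf{x}\le\mathbf{y}$ iff $x_i\le y_i$ for all $i$ (containment of Young diagrams), viewed as a category. Let $\|\mathbf{x}\|=\sum_i x_i$ be the sum norm. A $\mathscr{Y}$-module is a covariant functor $V$ from $\mathscr{Y}$ to the category of $k$-modules. Let $H_0(V)$ be the $\mathscr{Y}$-module with $$H_0(V)_{\mathbf{x}} = V_{\mathbf{x}} \Big/ \sum_{\mathbf{y}<\mathbf{x}} \operatorname{im}(V_{\mathbf{y}}\to V_{\mathbf{x}}),$$ let $H_s$ $(s\ge 0)$ be the $s$-th left derived functor of the right exact functor $H_0$, and let $$\operatorname{hd}_s(V)=\sup\{\|\mathbf{x}\| : H_s(V)_{\mathbf{x}}\neq 0\}\in\{-1,0,1,2,\dots\}\cup\{\infty\},$$ where the supremum is set to be $-1$ if $H_s(V)=0$. Say that $V$ is presented in finite degrees if $\max\{\operatorname{hd}_0(V),\operatorname{hd}_1(V)\}<\infty$.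 **Theorem.** 1. If a $\mathscr{Y}$-module $V$ is presented in finite degrees, then $\operatorname{hd}_s(V)<\infty$ for all $s\ge 0$. 2. The full subcategory of $\mathscr{Y}$-modules presented in finite degrees is an abelian subcategory of the category of all $\mathscr{Y}$-modules: it contains the zero module and is closed under finite direct sums, kernels and cokernels; in particular it is an abelian category. 3. For every $\mathscr{Y}$-module $V$ and every $s\ge 2$ with $\operatorname{hd}_{s-1}(V)>0$, one has $$\operatorname{hd}_s(V)\le \operatorname{hd}_{s-1}(V)\,\bigl(\ln \operatorname{hd}_{s-1}(V)+1\bigr),$$ where the right-hand side is read as $\infty$ if $\operatorname{hd}_{s-1}(V)=\infty$. -/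

import Mathlib

open CategoryTheory Limits

universe u

namespace YoungLattice

/-! The Young lattice is the poset `YoungDiagram` of Young diagrams (partitions) ordered by
containment, regarded as a category: there is one morphism `μ ⟶ ν` if `μ ≤ ν`, and none
otherwise. In row-length coordinates it consists of the finitely supported weakly decreasing
sequences of natural numbers `(μ.rowLen 0, μ.rowLen 1, …)` with the entrywise order. -/

/-- Containment of Young diagrams is the entrywise order on the sequences of row lengths. -/
theorem le_iff_rowLen_le (μ ν : YoungDiagram) : μ ≤ ν ↔ ∀ i, μ.rowLen i ≤ ν.rowLen i := by
  constructor
  · intro h i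
    by_contra hlt
    have hm : (i, ν.rowLen i) ∈ μ := YoungDiagram.mem_iff_lt_rowLen.2 (not_le.1 hlt)
    exact lt_irrefl _ (YoungDiagram.mem_iff_lt_rowLen.1 (h hm))
  · rintro h ⟨i, j⟩ hm
    exact YoungDiagram.mem_iff_lt_rowLen.2
      (lt_of_lt_of_le (YoungDiagram.mem_iff_lt_rowLen.1 hm) (h i))

/-- The sum norm: the sum of the (nonzero) entries of the partition. -/
def sumNorm (μ : YoungDiagram) : ℕ := μ.rowLens.sum

/-- The sum norm is the number of cells of the diagram. -/
theorem sumNorm_eq_card (μ : YoungDiagram) : sumNorm μ = μ.card := by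
  have h : ∀ c ∈ μ.cells, c.1 ∈ Finset.range (μ.colLen 0) := by
    rintro ⟨i, j⟩ hc
    have h0 : (i, 0) ∈ μ := μ.up_left_mem le_rfl (Nat.zero_le j) hc
    exact Finset.mem_range.2 (YoungDiagram.mem_iff_lt_colLen.1 h0)
  have h1 : sumNorm μ = ∑ i ∈ Finset.range (μ.colLen 0), μ.rowLen i := rfl
  rw [h1, YoungDiagram.card, Finset.card_eq_sum_card_fiberwise h]
  exact Finset.sum_congr rfl fun i _ => YoungDiagram.rowLen_eq_card μ

variable (k : Type u) [Field k]

/-- Representations of the Young lattice over `k`: covariant functors to `k`-modules. -/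
abbrev YModule : Type (u + 1) := YoungDiagram ⥤ ModuleCat.{u} k

/-- The category of representations has enough projectives: a representation `V` is a quotient of
the direct sum over `x` of representations freely generated by a free cover of `V x`. -/
instance enoughProjectives : EnoughProjectives (YModule k) where
  presentation V := by
    let D := ModuleCat.{u} k
    let L (x : YoungDiagram) : D ⥤ YModule k := evaluationLeftAdjoint (C := YoungDiagram) D x
    let adj (x : YoungDiagram) : L x ⊣ (evaluation YoungDiagram D).obj x :=
      evaluationAdjunctionRight D x
    let p (x : YoungDiagram) : Projective.over (V.obj x) ⟶ V.obj x := Projective.π (V.obj x)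
    let Q (x : YoungDiagram) : YModule k := (L x).obj (Projective.over (V.obj x))
    let f (x : YoungDiagram) : Q x ⟶ V := ((adj x).homEquiv _ V).symm (p x)
    have hQ (x : YoungDiagram) : Projective (Q x) :=
      (adj x).map_projective _ (Projective.projective_over (V.obj x))
    have hE : Epi (Sigma.desc f) := by
      have (x : YoungDiagram) : Epi ((Sigma.desc f).app x) := by
        have h1 : (adj x).homEquiv _ V (Sigma.ι Q x ≫ Sigma.desc f) = p x := by
          rw [Sigma.ι_desc]
          exact ((adj x).homEquiv _ V).apply_symm_apply (p x)
        rw [Adjunction.homEquiv_naturality_right] at h1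
        have h2 : Epi ((adj x).homEquiv _ _ (Sigma.ι Q x) ≫ (Sigma.desc f).app x) := by
          refine cast (congrArg Epi h1.symm) ?_
          exact Projective.π_epi (V.obj x)
        exact epi_of_epi ((adj x).homEquiv _ _ (Sigma.ι Q x)) _
      exact NatTrans.epi_of_epi_app _
    have hS : Projective (∐ Q) := by
      constructor
      intro E X g e he
      exact ⟨Sigma.desc fun x => Projective.factorThru (Sigma.ι Q x ≫ g) e, by cat_disch⟩
    exact ⟨{ p := ∐ Q, f := Sigma.desc f, projective := hS, epi := hE }⟩

variable {k}

/-- For a representation `V`, the submodule of `V x` generated by the images of all `V y` with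
`y < x`. -/
def decomposables (V : YModule k) (x : YoungDiagram) : Submodule k (V.obj x) :=
  ⨆ (y : YoungDiagram) (h : y < x), LinearMap.range (V.map (homOfLE h.le)).hom

theorem decomposables_le_comap_map (V : YModule k) {x y : YoungDiagram} (f : x ⟶ y) :
    decomposables V x ≤ (decomposables V y).comap (V.map f).hom := by
  refine iSup₂_le fun z hz => ?_
  rintro _ ⟨v, rfl⟩
  have hzy : z < y := lt_of_lt_of_le hz (leOfHom f)
  refine Submodule.mem_iSup_of_mem z (Submodule.mem_iSup_of_mem hzy ⟨v, ?_⟩)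
  have e : homOfLE hzy.le = homOfLE hz.le ≫ f := Subsingleton.elim _ _
  rw [e, V.map_comp]
  rfl

theorem decomposables_le_comap_app {V W : YModule k} (η : V ⟶ W) (x : YoungDiagram) :
    decomposables V x ≤ (decomposables W x).comap (η.app x).hom := by
  refine iSup₂_le fun z hz => ?_
  rintro _ ⟨v, rfl⟩
  refine Submodule.mem_iSup_of_mem z (Submodule.mem_iSup_of_mem hz ⟨(η.app z).hom v, ?_⟩)
  exact (ConcreteCategory.congr_hom (η.naturality (homOfLE hz.le)) v).symm

variable (k) in
/-- The zeroth homology functor `V ↦ V / 𝔍 V = (kY / 𝔍) ⊗_{kY} V`, where `𝔍` is the ideal of the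
category algebra `kY` spanned by the morphisms between distinct objects. Its value at `x` is
`V x` modulo the sum of the images of the `V y` with `y < x`. -/
def H0 : YModule k ⥤ YModule k where
  obj V :=
    { obj := fun x => ModuleCat.of k (V.obj x ⧸ decomposables V x)
      map := fun f => ModuleCat.ofHom
        (Submodule.mapQ _ _ (V.map f).hom (decomposables_le_comap_map V f))
      map_id := fun x => by
        ext v
        simp
      map_comp := fun f g => by
        ext v
        simp }
  map η :=
    { app := fun x => ModuleCat.ofHom
        (Submodule.mapQ _ _ (η.app x).hom (decomposables_le_comap_app η x))
      naturality := fun x y f => by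
        ext v
        exact congrArg (Submodule.Quotient.mk (p := decomposables _ y))
          (ConcreteCategory.congr_hom (η.naturality f) v) }
  map_id V := by
    ext x v
    simp
  map_comp η θ := by
    ext x v
    simp

instance H0_additive : (H0 k).Additive where
  map_add {V W η θ} := by
    apply NatTrans.ext
    funext x
    apply ModuleCat.hom_ext
    apply Submodule.linearMap_qext
    ext v
    rfl

/-- The homology `H_s(V) = Tor_s^{kY}(kY / 𝔍, V)`: the left derived functors of `H0`. -/
noncomputable def homology (s : ℕ) (V : YModule k) : YModule k :=
  ((H0 k).leftDerived s).obj V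

/-- The support of a representation: the set of all `x` with `V x ≠ 0`. -/
def support (V : YModule k) : Set YoungDiagram := {x | Nontrivial (V.obj x)}

open Classical in
/-- The `s`-th homological degree `hd_s(V)` with respect to the sum norm: the supremum of the norms
of the objects in the support of `H_s(V)` (possibly `⊤`), and `-1` if the support is empty. -/
noncomputable def hd (s : ℕ) (V : YModule k) : EReal :=
  if support (homology s V) = ∅ then -1
  else ⨆ x ∈ support (homology s V), (sumNorm x : EReal)

variable (k) in
/-- `V` is presented in finite degrees if its presentation degree `max {hd_0(V), hd_1(V)}` is
finite. -/
def PresentedInFiniteDegrees : ObjectProperty (YModule k) :=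
  fun V => max (hd 0 V) (hd 1 V) < ⊤

end YoungLattice

/-!
Every representation `V` has a projective cover, the free representation on its indecomposables
(`coverMap_surjective`, `mem_decomposables_of_coverMap_mem`), because Young diagrams have finitely
many subdiagrams and `k` is a field. Iterating gives a minimal resolution, whose differentials
vanish under `H0`. Hence `H_s(V)` lives exactly in the degrees of the generators of the `s`-th
syzygy (`support_homology`).

Fix a diagram `J`. A representation is generated in degrees contained in `J` if and only if all the
maps `V (x ⊓ J) → V x` are surjective (`support_H0_subset_Iic_iff`). If moreover its relations lie
in such degrees, these maps are bijective (`determinedBelow_of_support_subset`). Bijectivity is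
inherited by free representations on generators in degrees contained in `J`, and by all limits and
colimits, since these are computed pointwise. So it passes to the syzygies, and then the whole
homology is supported on diagrams contained in `J`. Consequently, being presented in finite degrees
means that the maps `V (x ⊓ J) → V x` are bijective for some `J`
(`presentedInFiniteDegrees_iff`), which gives both the finiteness of all homological degrees and
the closure under finite products, kernels and cokernels.

For the recursive bound, the syzygies of positive index are subobjects of free representations, so
their transition maps are injective. A relation at `x` between generators in degrees contained in
`J` thus already holds at `x ⊓ J`, and the support of `H_{n+2}(V)` is bounded by every `J` that
bounds the support of `H_{n+1}(V)` (`support_homology_succ_subset`). The join of all diagrams with at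
most `d` cells consists of the cells under the hyperbola `(i + 1) * (j + 1) ≤ d`, of which there are
at most `d / 1 + d / 2 + ⋯ + d / d ≤ d * (log d + 1)` (`sumNorm_hyperbola_le`).
-/

namespace YoungLattice

variable {k : Type u} [Field k]

/-! ### Free representations -/

theorem finite_Iic (x : YoungDiagram) : (Set.Iic x).Finite := by
  refine Set.Finite.of_finite_image (f := YoungDiagram.cells)
    (x.cells.powerset.finite_toSet.subset ?_) fun a _ b _ h => YoungDiagram.ext h
  rintro _ ⟨y, hy, rfl⟩
  exact Finset.mem_coe.2 (Finset.mem_powerset.2 hy)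

/-- The finite set of diagrams contained in `x`. -/
noncomputable def below (x : YoungDiagram) : Finset YoungDiagram := (finite_Iic x).toFinset

@[simp]
theorem mem_below {x y : YoungDiagram} : y ∈ below x ↔ y ≤ x := by
  simp [below]

open Classical in
/-- The transition map `V g → V x` of a representation, extended by zero to the pairs with
`¬ g ≤ x`. -/
noncomputable def transition (V : YModule k) (g x : YoungDiagram) : V.obj g →ₗ[k] V.obj x :=
  if h : g ≤ x then (V.map (homOfLE h)).hom else 0

theorem transition_of_le (V : YModule k) {g x : YoungDiagram} (h : g ≤ x) :
    transition V g x = (V.map (homOfLE h)).hom :=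
  dif_pos h

theorem transition_self (V : YModule k) (x : YoungDiagram) (v : V.obj x) :
    transition V x x v = v := by
  rw [transition_of_le V le_rfl]
  exact ConcreteCategory.congr_hom (V.map_id x) v

theorem map_transition (V : YModule k) {g x y : YoungDiagram} (h : g ≤ x) (f : x ⟶ y)
    (v : V.obj g) : (V.map f).hom (transition V g x v) = transition V g y v := by
  rw [transition_of_le V h, transition_of_le V (h.trans (leOfHom f))]
  exact (ConcreteCategory.congr_hom (V.map_comp (homOfLE h) f) v).symm

theorem transition_mem_decomposables (V : YModule k) {g x : YoungDiagram} (h : g < x)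
    (v : V.obj g) : transition V g x v ∈ decomposables V x := by
  refine Submodule.mem_iSup_of_mem g (Submodule.mem_iSup_of_mem h ⟨v, ?_⟩)
  rw [transition_of_le V h.le]

theorem app_transition {V W : YModule k} (η : V ⟶ W) (g x : YoungDiagram) (v : V.obj g) :
    (η.app x).hom (transition V g x v) = transition W g x ((η.app g).hom v) := by
  by_cases h : g ≤ x
  · rw [transition_of_le V h, transition_of_le W h]
    exact ConcreteCategory.congr_hom (η.naturality (homOfLE h)) v
  · simp [transition, h]

variable (M : YoungDiagram → ModuleCat.{u} k)

/-- The families `(φ g)` with `φ g ∈ M g` that vanish outside the diagrams `g ≤ x`. -/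
def freeSections (x : YoungDiagram) : Submodule k (∀ g, M g) where
  carrier := {φ | ∀ g, ¬ g ≤ x → φ g = 0}
  add_mem' ha hb g hg := by simp [ha g hg, hb g hg]
  zero_mem' _ _ := rfl
  smul_mem' c _ ha g hg := by simp [ha g hg]

theorem freeSections_mono {x y : YoungDiagram} (h : x ≤ y) :
    freeSections M x ≤ freeSections M y :=
  fun _ hφ g hg => hφ g fun hgx => hg (hgx.trans h)

/-- The free representation on a family of vector spaces: its value at `x` is the direct sum of the
`M g` with `g ≤ x`, encoded as the families `(φ g)` supported in `{g | g ≤ x}`, so that the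
transition maps are inclusions. -/
def free : YModule k where
  obj x := ModuleCat.of k (freeSections M x)
  map f := ModuleCat.ofHom (Submodule.inclusion (freeSections_mono M (leOfHom f)))

theorem free_map_injective {x y : YoungDiagram} (f : x ⟶ y) :
    Function.Injective ((free M).map f).hom :=
  Submodule.inclusion_injective (freeSections_mono M (leOfHom f))

variable {M}

theorem transition_free_val {g x : YoungDiagram} (h : g ≤ x) (φ : (free M).obj g) :
    (transition (free M) g x φ).1 = φ.1 := by
  rw [transition_of_le _ h]
  rfl

open Classical in
/-- The inclusion of the space of generators `M g` into the free representation. -/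
noncomputable def gen (g : YoungDiagram) : M g →ₗ[k] (free M).obj g :=
  (LinearMap.single k (fun g => M g) g).codRestrict (freeSections M g) fun m h hh => by
    rw [LinearMap.single_apply, Pi.single_eq_of_ne fun e : h = g => hh e.le]

open Classical in
theorem gen_val (g : YoungDiagram) (m : M g) :
    (gen g m).1 = LinearMap.single k (fun g => M g) g m :=
  rfl

@[simp]
theorem gen_val_self (g : YoungDiagram) (m : M g) : (gen g m).1 g = m := by
  classical rw [gen_val, LinearMap.single_apply, Pi.single_eq_same]

theorem gen_val_of_ne {g h : YoungDiagram} (e : h ≠ g) (m : M g) : (gen g m).1 h = 0 := by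
  classical rw [gen_val, LinearMap.single_apply, Pi.single_eq_of_ne e]

/-- An element of a free representation is the sum of its components. -/
theorem eq_sum_gen {x : YoungDiagram} (φ : (free M).obj x) :
    φ = ∑ g ∈ below x, transition (free M) g x (gen g (φ.1 g)) := by
  apply Subtype.ext
  have h1 : (∑ g ∈ below x, transition (free M) g x (gen g (φ.1 g))).1 =
      ∑ g ∈ below x, (gen g (φ.1 g)).1 := by
    refine ((freeSections M x).coe_sum _ _).trans (Finset.sum_congr rfl fun g hg => ?_)
    exact transition_free_val (mem_below.1 hg) _
  rw [h1]
  funext h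
  rw [Finset.sum_apply]
  by_cases hh : h ≤ x
  · rw [Finset.sum_eq_single h (fun g _ hg => gen_val_of_ne hg.symm _)
      (fun hx => (hx (mem_below.2 hh)).elim), gen_val_self]
  · rw [φ.2 h hh]
    refine (Finset.sum_eq_zero fun g hg => ?_).symm
    exact gen_val_of_ne (fun e : h = g => hh (e.le.trans (mem_below.1 hg))) _

/-- The value at `x` of the morphism `freeDesc`. -/
noncomputable def freeDescApp {V : YModule k} (σ : ∀ g, M g →ₗ[k] V.obj g) (x : YoungDiagram) :
    freeSections M x →ₗ[k] V.obj x :=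
  ∑ g ∈ below x, transition V g x ∘ₗ σ g ∘ₗ LinearMap.proj g ∘ₗ (freeSections M x).subtype

theorem freeDescApp_apply {V : YModule k} (σ : ∀ g, M g →ₗ[k] V.obj g) {x : YoungDiagram}
    (φ : freeSections M x) :
    freeDescApp σ x φ = ∑ g ∈ below x, transition V g x (σ g (φ.1 g)) :=
  LinearMap.sum_apply _ _ _

theorem map_freeDescApp {V : YModule k} (σ : ∀ g, M g →ₗ[k] V.obj g) {x y : YoungDiagram}
    (f : x ⟶ y) (φ : freeSections M x) :
    (V.map f).hom (freeDescApp σ x φ) =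
      freeDescApp σ y (Submodule.inclusion (freeSections_mono M (leOfHom f)) φ) := by
  have hxy : below x ⊆ below y := fun g hg =>
    mem_below.2 ((mem_below.1 hg).trans (leOfHom f))
  rw [freeDescApp_apply, freeDescApp_apply, map_sum, ← Finset.sum_subset hxy]
  · exact Finset.sum_congr rfl fun g hg => map_transition V (mem_below.1 hg) f _
  · intro g _ hg
    change transition V g y (σ g (φ.1 g)) = 0
    rw [φ.2 g fun h => hg (mem_below.2 h), map_zero, map_zero]

/-- The universal property of free representations: a morphism out of `free M` is given by its
values on the generators. -/
noncomputable def freeDesc {V : YModule k} (σ : ∀ g, M g →ₗ[k] V.obj g) : free M ⟶ V where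
  app x := ModuleCat.ofHom (freeDescApp σ x)
  naturality x y f := by
    ext φ
    exact (map_freeDescApp σ f φ).symm

theorem freeDesc_app {V : YModule k} (σ : ∀ g, M g →ₗ[k] V.obj g) {x : YoungDiagram}
    (φ : (free M).obj x) :
    ((freeDesc σ).app x).hom φ = ∑ g ∈ below x, transition V g x (σ g (φ.1 g)) :=
  freeDescApp_apply σ φ

theorem freeDesc_gen {V : YModule k} (σ : ∀ g, M g →ₗ[k] V.obj g) (g : YoungDiagram) (m : M g) :
    ((freeDesc σ).app g).hom (gen g m) = σ g m := by
  rw [freeDesc_app, Finset.sum_eq_single g, gen_val_self, transition_self]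
  · intro h _ hh
    rw [gen_val_of_ne hh, map_zero, map_zero]
  · exact fun h => (h (mem_below.2 le_rfl)).elim

theorem free_hom_ext {V : YModule k} {η θ : free M ⟶ V}
    (h : ∀ g m, (η.app g).hom (gen g m) = (θ.app g).hom (gen g m)) : η = θ := by
  ext x φ
  rw [eq_sum_gen φ, map_sum, map_sum]
  refine Finset.sum_congr rfl fun g _ => ?_
  rw [app_transition, app_transition, h]

theorem epi_iff_surjective {V W : YModule k} (η : V ⟶ W) :
    Epi η ↔ ∀ x, Function.Surjective (η.app x).hom := by
  rw [NatTrans.epi_iff_epi_app]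
  exact forall_congr' fun x => ModuleCat.epi_iff_surjective _

instance free_projective : Projective (free M) where
  factors {E X} f e he := by
    have hs := (epi_iff_surjective e).1 he
    have hr (g : YoungDiagram) : ∃ r : X.obj g →ₗ[k] E.obj g, (e.app g).hom ∘ₗ r = .id :=
      (e.app g).hom.exists_rightInverse_of_surjective (LinearMap.range_eq_top.2 (hs g))
    choose r hr using hr
    refine ⟨freeDesc fun g => r g ∘ₗ (f.app g).hom ∘ₗ gen g, free_hom_ext fun g m => ?_⟩
    change (e.app g).hom (((freeDesc _).app g).hom (gen g m)) = _
    rw [freeDesc_gen]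
    exact LinearMap.congr_fun (hr g) _

/-- The decomposables of a free representation at `x` are the families with zero component at
`x`. -/
theorem mem_decomposables_free {x : YoungDiagram} (φ : (free M).obj x) :
    φ ∈ decomposables (free M) x ↔ φ.1 x = 0 := by
  constructor
  · let ev : (free M).obj x →ₗ[k] M x := LinearMap.proj x ∘ₗ (freeSections M x).subtype
    have h : decomposables (free M) x ≤ LinearMap.ker ev := by
      refine iSup₂_le fun y hy => ?_
      rintro _ ⟨ψ, rfl⟩
      exact ψ.2 x hy.not_ge
    exact fun hφ => h hφ
  · intro h
    rw [eq_sum_gen φ]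
    refine Submodule.sum_mem _ fun g hg => ?_
    rcases (mem_below.1 hg).eq_or_lt with rfl | hlt
    · rw [h, map_zero, map_zero]
      exact zero_mem _
    · exact transition_mem_decomposables _ hlt _

/-- The indecomposables of a free representation are its spaces of generators. -/
theorem support_H0_free : support ((H0 k).obj (free M)) = {x | Nontrivial (M x)} := by
  ext x
  let ev : (free M).obj x →ₗ[k] M x := LinearMap.proj x ∘ₗ (freeSections M x).subtype
  have hker : decomposables (free M) x = LinearMap.ker ev := by
    ext φ
    exact mem_decomposables_free φ
  have hsurj : Function.Surjective ev := fun m => ⟨gen x m, gen_val_self x m⟩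
  let e : ((free M).obj x ⧸ decomposables (free M) x) ≃ₗ[k] M x :=
    (Submodule.quotEquivOfEq _ _ hker).trans (ev.quotKerEquivOfSurjective hsurj)
  exact e.toEquiv.nontrivial_congr

/-! ### Minimal resolutions -/

/-- The indecomposables of `V` at `g`, that is, the value at `g` of `H0 V`. -/
noncomputable def indec (V : YModule k) (g : YoungDiagram) : ModuleCat.{u} k :=
  ModuleCat.of k (V.obj g ⧸ decomposables V g)

/-- The projection of `V` onto its indecomposables. -/
noncomputable def indecMk (V : YModule k) (g : YoungDiagram) : V.obj g →ₗ[k] indec V g :=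
  (decomposables V g).mkQ

theorem indecMk_eq_zero {V : YModule k} {g : YoungDiagram} {v : V.obj g} :
    indecMk V g v = 0 ↔ v ∈ decomposables V g :=
  Submodule.Quotient.mk_eq_zero _

theorem exists_section (V : YModule k) (g : YoungDiagram) :
    ∃ σ : indec V g →ₗ[k] V.obj g, indecMk V g ∘ₗ σ = .id :=
  (indecMk V g).exists_rightInverse_of_surjective (Submodule.range_mkQ _)

/-- A linear choice of representatives for the indecomposables of `V` at `g`. -/
noncomputable def indecLift (V : YModule k) (g : YoungDiagram) : indec V g →ₗ[k] V.obj g :=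
  (exists_section V g).choose

theorem indecMk_indecLift (V : YModule k) (g : YoungDiagram) (m : indec V g) :
    indecMk V g (indecLift V g m) = m :=
  LinearMap.congr_fun (exists_section V g).choose_spec m

/-- The projective cover of `V`: the free representation on its indecomposables. -/
noncomputable def cover (V : YModule k) : YModule k :=
  free (indec V)

instance (V : YModule k) : Projective (cover V) :=
  inferInstanceAs (Projective (free (indec V)))

/-- The projection of the projective cover of `V` onto `V`. -/
noncomputable def coverMap (V : YModule k) : cover V ⟶ V :=
  freeDesc (indecLift V)

/-- Nakayama's lemma for representations of the Young lattice, by induction on the number of cells: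
lifts of the indecomposables generate. -/
theorem coverMap_surjective (V : YModule k) (x : YoungDiagram) :
    Function.Surjective ((coverMap V).app x).hom := by
  induction h : x.card using Nat.strong_induction_on generalizing x with
  | _ n ih =>
    subst h
    rw [← LinearMap.range_eq_top, eq_top_iff]
    have hdec : decomposables V x ≤ LinearMap.range ((coverMap V).app x).hom := by
      refine iSup₂_le fun y hy => ?_
      rintro _ ⟨v, rfl⟩
      obtain ⟨φ, rfl⟩ := ih _ (Finset.card_lt_card hy) y rfl v
      exact ⟨_, ConcreteCategory.congr_hom ((coverMap V).naturality (homOfLE hy.le)) φ⟩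
    intro v _
    have h1 : v - indecLift V x (indecMk V x v) ∈ decomposables V x := by
      rw [← indecMk_eq_zero, map_sub, indecMk_indecLift, sub_self]
    have h2 : indecLift V x (indecMk V x v) ∈ LinearMap.range ((coverMap V).app x).hom :=
      ⟨gen x (indecMk V x v), freeDesc_gen _ _ _⟩
    have h3 := Submodule.add_mem _ (hdec h1) h2
    rwa [sub_add_cancel] at h3

instance coverMap_epi (V : YModule k) : Epi (coverMap V) :=
  (epi_iff_surjective _).2 (coverMap_surjective V)

open Classical in
/-- Minimality of the projective cover: an element of the cover whose image is decomposable is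
itself decomposable. -/
theorem mem_decomposables_of_coverMap_mem (V : YModule k) {x : YoungDiagram}
    (φ : (cover V).obj x) (h : ((coverMap V).app x).hom φ ∈ decomposables V x) :
    φ ∈ decomposables (cover V) x := by
  refine (mem_decomposables_free φ).2 ?_
  have h1 : ((coverMap V).app x).hom φ = transition V x x (indecLift V x (φ.1 x)) +
      ∑ g ∈ (below x).erase x, transition V g x (indecLift V g (φ.1 g)) :=
    (freeDesc_app _ _).trans (Finset.add_sum_erase _
      (fun g => transition V g x (indecLift V g (φ.1 g))) (mem_below.2 le_rfl)).symm
  have h2 : ∑ g ∈ (below x).erase x, transition V g x (indecLift V g (φ.1 g)) ∈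
      decomposables V x :=
    Submodule.sum_mem _ fun g hg => transition_mem_decomposables V
      (lt_of_le_of_ne (mem_below.1 (Finset.mem_of_mem_erase hg)) (Finset.ne_of_mem_erase hg)) _
  rw [h1, Submodule.add_mem_iff_left _ h2, transition_self] at h
  exact (indecMk_indecLift V x (φ.1 x)).symm.trans (indecMk_eq_zero.2 h)

/-- The syzygies of a representation in its minimal resolution. -/
noncomputable def syzygy (V : YModule k) : ℕ → YModule k
  | 0 => V
  | n + 1 => kernel (coverMap (syzygy V n))

/-- The inclusion of a syzygy into the preceding term of the minimal resolution. -/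
noncomputable def syzygyι (V : YModule k) (n : ℕ) : syzygy V (n + 1) ⟶ cover (syzygy V n) :=
  kernel.ι (coverMap (syzygy V n))

instance (V : YModule k) (n : ℕ) : Mono (syzygyι V n) :=
  inferInstanceAs (Mono (kernel.ι (coverMap (syzygy V n))))

theorem syzygyι_comp (V : YModule k) (n : ℕ) : syzygyι V n ≫ coverMap (syzygy V n) = 0 :=
  kernel.condition _

theorem exact_syzygyι (V : YModule k) (n : ℕ) :
    (ShortComplex.mk _ _ (syzygyι_comp V n)).Exact :=
  ShortComplex.exact_kernel _

/-- The differential of the minimal resolution. -/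
noncomputable def minimalD (V : YModule k) (n : ℕ) :
    cover (syzygy V (n + 1)) ⟶ cover (syzygy V n) :=
  coverMap (syzygy V (n + 1)) ≫ syzygyι V n

theorem minimalD_comp_coverMap (V : YModule k) (n : ℕ) :
    minimalD V n ≫ coverMap (syzygy V n) = 0 := by
  rw [minimalD, Category.assoc, syzygyι_comp, comp_zero]

theorem minimalD_comp (V : YModule k) (n : ℕ) : minimalD V (n + 1) ≫ minimalD V n = 0 := by
  rw [minimalD.eq_1 V n, ← Category.assoc, minimalD_comp_coverMap, zero_comp]

theorem exact_minimalD_coverMap (V : YModule k) (n : ℕ) :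
    (ShortComplex.mk _ _ (minimalD_comp_coverMap V n)).Exact := by
  let α : ShortComplex.mk _ _ (minimalD_comp_coverMap V n) ⟶
      ShortComplex.mk _ _ (syzygyι_comp V n) :=
    { τ₁ := coverMap (syzygy V (n + 1))
      τ₂ := 𝟙 _
      τ₃ := 𝟙 _
      comm₁₂ := (Category.comp_id _).symm
      comm₂₃ := (Category.id_comp _).trans (Category.comp_id _).symm }
  have : Epi α.τ₁ := coverMap_epi _
  have : IsIso α.τ₂ := inferInstanceAs (IsIso (𝟙 _))
  have : Mono α.τ₃ := inferInstanceAs (Mono (𝟙 _))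
  exact (ShortComplex.exact_iff_of_epi_of_isIso_of_mono α).2 (exact_syzygyι V n)

theorem exact_minimalD (V : YModule k) (n : ℕ) :
    (ShortComplex.mk _ _ (minimalD_comp V n)).Exact := by
  let α : ShortComplex.mk _ _ (minimalD_comp_coverMap V (n + 1)) ⟶
      ShortComplex.mk _ _ (minimalD_comp V n) :=
    { τ₁ := 𝟙 _
      τ₂ := 𝟙 _
      -- Composing with a monomorphism leaves the kernel unchanged.
      τ₃ := syzygyι V n
      comm₁₂ := (Category.id_comp _).trans (Category.comp_id _).symm
      comm₂₃ := Category.id_comp _ }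
  have : Epi α.τ₁ := inferInstanceAs (Epi (𝟙 _))
  have : IsIso α.τ₂ := inferInstanceAs (IsIso (𝟙 _))
  have : Mono α.τ₃ := inferInstanceAs (Mono (syzygyι V n))
  exact (ShortComplex.exact_iff_of_epi_of_isIso_of_mono α).1 (exact_minimalD_coverMap V (n + 1))

/-- The minimal resolution of a representation, as a chain complex. -/
noncomputable def minimalComplex (V : YModule k) : ChainComplex (YModule k) ℕ :=
  ChainComplex.of (fun n => cover (syzygy V n)) (minimalD V) (minimalD_comp V)

theorem minimalComplex_d (V : YModule k) (n : ℕ) :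
    (minimalComplex V).d (n + 1) n = minimalD V n :=
  ChainComplex.of_d (fun n => cover (syzygy V n)) (minimalD V) n

theorem minimalComplex_exactAt_succ (V : YModule k) (n : ℕ) :
    (minimalComplex V).ExactAt (n + 1) := by
  rw [HomologicalComplex.exactAt_iff' _ (n + 2) (n + 1) n (by simp) (by simp)]
  refine (ShortComplex.exact_iff_of_iso ?_).1 (exact_minimalD V n)
  exact ShortComplex.isoMk (Iso.refl _) (Iso.refl _) (Iso.refl _)
    ((Category.id_comp _).trans ((minimalComplex_d V (n + 1)).trans (Category.comp_id _).symm))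
    ((Category.id_comp _).trans ((minimalComplex_d V n).trans (Category.comp_id _).symm))

/-- The minimal resolution of a representation, as a projective resolution. -/
noncomputable def minimalResolution (V : YModule k) : ProjectiveResolution V where
  complex := minimalComplex V
  projective n := inferInstanceAs (Projective (cover (syzygy V n)))
  π := (ChainComplex.toSingle₀Equiv _ _).symm ⟨coverMap V, by
    rw [minimalComplex_d]
    exact minimalD_comp_coverMap V 0⟩
  quasiIso := ⟨fun n => by
    cases n
    · rw [ChainComplex.quasiIsoAt₀_iff, ShortComplex.quasiIso_iff_of_zeros']
      · refine (ShortComplex.exact_and_epi_g_iff_of_iso ?_).1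
          ⟨exact_minimalD_coverMap V 0, coverMap_epi V⟩
        exact ShortComplex.isoMk (Iso.refl _) (Iso.refl _) (Iso.refl _)
          ((Category.id_comp _).trans ((minimalComplex_d V 0).trans (Category.comp_id _).symm))
          ((Category.id_comp _).trans ((ChainComplex.toSingle₀Equiv_symm_apply_f_zero _ _).trans
            (Category.comp_id _).symm))
      all_goals rfl
    · rw [quasiIsoAt_iff_exactAt']
      · apply minimalComplex_exactAt_succ
      · apply ChainComplex.exactAt_succ_single_obj⟩

theorem H0_map_eq_zero {V W : YModule k} (η : V ⟶ W)
    (h : ∀ x v, (η.app x).hom v ∈ decomposables W x) : (H0 k).map η = 0 := by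
  apply NatTrans.ext
  funext x
  apply ModuleCat.hom_ext
  apply Submodule.linearMap_qext
  ext v
  exact (Submodule.Quotient.mk_eq_zero _).2 (h x v)

/-- Boundaries map to zero, hence to decomposables, so minimality makes them decomposable. -/
theorem H0_map_minimalD (V : YModule k) (n : ℕ) : (H0 k).map (minimalD V n) = 0 := by
  refine H0_map_eq_zero _ fun x v => mem_decomposables_of_coverMap_mem _ _ ?_
  have h : ((coverMap (syzygy V n)).app x).hom (((minimalD V n).app x).hom v) = 0 :=
    ConcreteCategory.congr_hom (NatTrans.congr_app (minimalD_comp_coverMap V n) x) v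
  rw [h]
  exact zero_mem _

theorem H0_map_minimalComplex_d (V : YModule k) (i j : ℕ) :
    (H0 k).map ((minimalComplex V).d i j) = 0 := by
  by_cases h : (ComplexShape.down ℕ).Rel i j
  · obtain rfl : j + 1 = i := h
    exact (congrArg _ (minimalComplex_d V j)).trans (H0_map_minimalD V j)
  · rw [(minimalComplex V).shape i j h, Functor.map_zero]

/-- The minimal resolution becomes a complex with zero differentials under `H0`, so that its terms
compute the homology. -/
noncomputable def homologyIso (s : ℕ) (V : YModule k) :
    homology s V ≅ (H0 k).obj (cover (syzygy V s)) :=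
  (minimalResolution V).isoLeftDerivedObj (H0 k) s ≪≫
    (ShortComplex.HomologyData.ofZeros _ (H0_map_minimalComplex_d V _ _)
      (H0_map_minimalComplex_d V _ _)).left.homologyIso

theorem support_eq_of_iso {V W : YModule k} (e : V ≅ W) : support V = support W := by
  ext x
  exact (e.app x).toLinearEquiv.toEquiv.nontrivial_congr

/-- The homology of a representation is supported on the degrees of the generators of its
syzygies. -/
theorem support_homology (s : ℕ) (V : YModule k) :
    support (homology s V) = support ((H0 k).obj (syzygy V s)) :=
  (support_eq_of_iso (homologyIso s V)).trans support_H0_free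

theorem syzygyι_injective (V : YModule k) (n : ℕ) (x : YoungDiagram) :
    Function.Injective ((syzygyι V n).app x).hom :=
  (ModuleCat.mono_iff_injective _).1 inferInstance

theorem exists_syzygyι_eq (V : YModule k) (n : ℕ) {x : YoungDiagram}
    (φ : (cover (syzygy V n)).obj x) (h : ((coverMap (syzygy V n)).app x).hom φ = 0) :
    ∃ v, ((syzygyι V n).app x).hom v = φ :=
  ((ShortComplex.moduleCat_exact_iff _).1
    ((exact_syzygyι V n).map ((evaluation _ _).obj x))) φ h

/-! ### Representations determined by the diagrams inside a fixed one -/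

/-- The representations `V` that are determined by their restriction to the diagrams contained in
`J`: the map `V (x ⊓ J) → V x` is an isomorphism for all `x`. -/
def determinedBelow (k : Type u) [Field k] (J : YoungDiagram) : ObjectProperty (YModule k) :=
  fun V => ∀ x : YoungDiagram, IsIso (V.map (homOfLE (inf_le_left : x ⊓ J ≤ x)))

theorem isIso_map_iff_bijective (V : YModule k) {x y : YoungDiagram} (f : x ⟶ y) :
    IsIso (V.map f) ↔ Function.Bijective (V.map f).hom :=
  ConcreteCategory.isIso_iff_bijective _

/-- Evaluation at a diagram preserves limits, and limits of isomorphisms are isomorphisms. -/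
instance isClosedUnderLimitsOfShape_determinedBelow (J : YoungDiagram) (S : Type)
    [SmallCategory S] : (determinedBelow k J).IsClosedUnderLimitsOfShape S where
  limitsOfShape_le := by
    rintro V ⟨p⟩ x
    let τ := (evaluation YoungDiagram (ModuleCat.{u} k)).map (homOfLE (inf_le_left : x ⊓ J ≤ x))
    have hiso : ∀ s : S, IsIso ((Functor.whiskerLeft p.diag τ).app s) := fun s =>
      p.prop_diag_obj s x
    have : IsIso (Functor.whiskerLeft p.diag τ) := NatIso.isIso_of_isIso_app _
    let e := IsLimit.conePointsIsoOfNatIso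
      (isLimitOfPreserves ((evaluation YoungDiagram (ModuleCat.{u} k)).obj (x ⊓ J)) p.isLimit)
      (isLimitOfPreserves ((evaluation YoungDiagram (ModuleCat.{u} k)).obj x) p.isLimit)
      (asIso (Functor.whiskerLeft p.diag τ))
    have he : e.hom = V.map (homOfLE inf_le_left) := by
      refine (isLimitOfPreserves ((evaluation YoungDiagram (ModuleCat.{u} k)).obj x)
        p.isLimit).hom_ext fun s => ?_
      rw [IsLimit.conePointsIsoOfNatIso_hom_comp]
      exact ((p.π.app s).naturality (homOfLE inf_le_left)).symm
    rw [← he]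
    infer_instance

/-- Evaluation at a diagram preserves colimits, and colimits of isomorphisms are isomorphisms. -/
instance isClosedUnderColimitsOfShape_determinedBelow (J : YoungDiagram) (S : Type)
    [SmallCategory S] : (determinedBelow k J).IsClosedUnderColimitsOfShape S where
  colimitsOfShape_le := by
    rintro V ⟨p⟩ x
    let τ := (evaluation YoungDiagram (ModuleCat.{u} k)).map (homOfLE (inf_le_left : x ⊓ J ≤ x))
    have hiso : ∀ s : S, IsIso ((Functor.whiskerLeft p.diag τ).app s) := fun s =>
      p.prop_diag_obj s x
    have : IsIso (Functor.whiskerLeft p.diag τ) := NatIso.isIso_of_isIso_app _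
    let e := IsColimit.coconePointsIsoOfNatIso
      (isColimitOfPreserves ((evaluation YoungDiagram (ModuleCat.{u} k)).obj (x ⊓ J)) p.isColimit)
      (isColimitOfPreserves ((evaluation YoungDiagram (ModuleCat.{u} k)).obj x) p.isColimit)
      (asIso (Functor.whiskerLeft p.diag τ))
    have he : e.hom = V.map (homOfLE inf_le_left) := by
      refine (isColimitOfPreserves ((evaluation YoungDiagram (ModuleCat.{u} k)).obj (x ⊓ J))
        p.isColimit).hom_ext fun s => ?_
      rw [IsColimit.comp_coconePointsIsoOfNatIso_hom]
      exact ((p.ι.app s).naturality (homOfLE inf_le_left))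
    rw [← he]
    infer_instance

theorem determinedBelow_of_isLimit_kernelFork {J : YoungDiagram} {V W : YModule k} {f : V ⟶ W}
    {c : KernelFork f} (hc : IsLimit c) (hV : determinedBelow k J V)
    (hW : determinedBelow k J W) : determinedBelow k J c.pt := by
  refine (determinedBelow k J).prop_of_isLimit hc ?_
  rintro (_ | _) <;> assumption

theorem determinedBelow_of_isColimit_cokernelCofork {J : YoungDiagram} {V W : YModule k}
    {f : V ⟶ W} {c : CokernelCofork f} (hc : IsColimit c) (hV : determinedBelow k J V)
    (hW : determinedBelow k J W) : determinedBelow k J c.pt := by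
  refine (determinedBelow k J).prop_of_isColimit hc ?_
  rintro (_ | _) <;> assumption

theorem free_map_inf_surjective {M : YoungDiagram → ModuleCat.{u} k} {J : YoungDiagram}
    (hM : ∀ g, Nontrivial (M g) → g ≤ J) (x : YoungDiagram) :
    Function.Surjective ((free M).map (homOfLE (inf_le_left : x ⊓ J ≤ x))).hom := by
  intro φ
  refine ⟨⟨φ.1, fun g hg => ?_⟩, Subtype.ext rfl⟩
  by_cases hx : g ≤ x
  · have : Subsingleton (M g) := not_nontrivial_iff_subsingleton.1 fun h =>
      hg (le_inf hx (hM g h))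
    exact Subsingleton.elim _ _
  · exact φ.2 g hx

theorem determinedBelow_free {M : YoungDiagram → ModuleCat.{u} k} {J : YoungDiagram}
    (hM : ∀ g, Nontrivial (M g) → g ≤ J) : determinedBelow k J (free M) := fun x =>
  (isIso_map_iff_bijective _ _).2 ⟨free_map_injective M _, free_map_inf_surjective hM x⟩

/-- A representation is generated in degrees contained in `J` if and only if the maps
`V (x ⊓ J) → V x` are surjective. -/
theorem support_H0_subset_Iic_iff (V : YModule k) (J : YoungDiagram) :
    support ((H0 k).obj V) ⊆ Set.Iic J ↔
      ∀ x : YoungDiagram,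
        Function.Surjective (V.map (homOfLE (inf_le_left : x ⊓ J ≤ x))).hom := by
  constructor
  · intro h x v
    obtain ⟨φ, rfl⟩ := coverMap_surjective V x v
    obtain ⟨ψ, rfl⟩ := free_map_inf_surjective (M := indec V) (fun g hg => h hg) x φ
    exact ⟨_, (ConcreteCategory.congr_hom ((coverMap V).naturality (homOfLE inf_le_left)) ψ).symm⟩
  · intro h x hx
    by_contra hJ
    have hlt : x ⊓ J < x := lt_of_le_of_ne inf_le_left fun e => hJ (inf_eq_left.1 e)
    have htop : decomposables V x = ⊤ := by
      refine eq_top_iff.2 fun v _ => ?_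
      obtain ⟨w, rfl⟩ := h x v
      exact Submodule.mem_iSup_of_mem _ (Submodule.mem_iSup_of_mem hlt ⟨w, rfl⟩)
    have : Nontrivial (V.obj x ⧸ decomposables V x) := hx
    exact Submodule.Quotient.nontrivial_iff.1 this htop

theorem determinedBelow_syzygy {V : YModule k} {J : YoungDiagram} (h : determinedBelow k J V)
    (n : ℕ) : determinedBelow k J (syzygy V n) := by
  induction n with
  | zero => exact h
  | succ n ih =>
    refine determinedBelow_of_isLimit_kernelFork 
      (limit.isLimit (parallelPair (coverMap (syzygy V n)) 0))
      (determinedBelow_free fun g hg => ?_) ih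
    exact (support_H0_subset_Iic_iff _ J).2
      (fun x => ((isIso_map_iff_bijective _ _).1 (ih x)).2) hg

theorem support_homology_subset_of_determinedBelow {V : YModule k} {J : YoungDiagram}
    (h : determinedBelow k J V) (s : ℕ) : support (homology s V) ⊆ Set.Iic J := by
  rw [support_homology, support_H0_subset_Iic_iff]
  exact fun x => ((isIso_map_iff_bijective _ _).1 (determinedBelow_syzygy h s x)).2

/-- A representation whose generators and relations lie in degrees contained in `J` is determined
by its restriction to the diagrams contained in `J`. -/
theorem determinedBelow_of_support_subset {V : YModule k} {J : YoungDiagram}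
    (h0 : support (homology 0 V) ⊆ Set.Iic J) (h1 : support (homology 1 V) ⊆ Set.Iic J) :
    determinedBelow k J V := by
  rw [support_homology, support_H0_subset_Iic_iff] at h0 h1
  intro x
  rw [isIso_map_iff_bijective]
  refine ⟨(injective_iff_map_eq_zero _).2 fun v hv => ?_, h0 x⟩
  -- Lift `v` to the cover; its image at `x` is a relation, which already exists at `x ⊓ J`.
  obtain ⟨φ, rfl⟩ := coverMap_surjective V _ v
  have nat := ConcreteCategory.congr_hom
    ((coverMap V).naturality (homOfLE (inf_le_left : x ⊓ J ≤ x))) φ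
  obtain ⟨r, hr⟩ := exists_syzygyι_eq V 0 (((cover V).map (homOfLE inf_le_left)).hom φ)
    (nat.trans hv)
  obtain ⟨r', rfl⟩ := h1 x r
  have nat' := ConcreteCategory.congr_hom
    ((syzygyι V 0).naturality (homOfLE (inf_le_left : x ⊓ J ≤ x))) r'
  have hφ : ((syzygyι V 0).app (x ⊓ J)).hom r' = φ :=
    free_map_injective _ _ (nat'.symm.trans hr)
  rw [← hφ]
  exact ConcreteCategory.congr_hom (NatTrans.congr_app (syzygyι_comp V 0) (x ⊓ J)) r'

theorem syzygy_map_injective (V : YModule k) (n : ℕ) {x y : YoungDiagram} (f : x ⟶ y) :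
    Function.Injective ((syzygy V (n + 1)).map f).hom := by
  intro v w h
  apply syzygyι_injective V n x
  apply free_map_injective _ f
  have hv := ConcreteCategory.congr_hom ((syzygyι V n).naturality f) v
  have hw := ConcreteCategory.congr_hom ((syzygyι V n).naturality f) w
  exact hv.symm.trans ((congrArg _ h).trans hw)

/-- In homological degrees at least `2`, homology is supported below any diagram that contains the
support of the preceding homology. The reason is that the transition maps of a syzygy of positive
index are injective, so that a relation at `x` between generators in degrees contained in `J` already
holds at `x ⊓ J`. -/
theorem support_homology_succ_subset (V : YModule k) (n : ℕ) {J : YoungDiagram}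
    (h : support (homology (n + 1) V) ⊆ Set.Iic J) :
    support (homology (n + 2) V) ⊆ Set.Iic J := by
  rw [support_homology] at h ⊢
  rw [support_H0_subset_Iic_iff]
  intro x r
  -- As an element of the cover, the relation `r` comes from some `φ` at `x ⊓ J`, and injectivity
  -- of the transition maps of the syzygy shows that `φ` is a relation there.
  obtain ⟨φ, hφ⟩ := free_map_inf_surjective (M := indec (syzygy V (n + 1)))
    (fun g hg => h hg) x (((syzygyι V (n + 1)).app x).hom r)
  have nat := ConcreteCategory.congr_hom ((coverMap (syzygy V (n + 1))).naturality
    (homOfLE (inf_le_left : x ⊓ J ≤ x))) φ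
  have hz : ((coverMap (syzygy V (n + 1))).app x).hom (((syzygyι V (n + 1)).app x).hom r) = 0 :=
    ConcreteCategory.congr_hom (NatTrans.congr_app (syzygyι_comp V (n + 1)) x) r
  have hφ0 : ((coverMap (syzygy V (n + 1))).app (x ⊓ J)).hom φ = 0 := by
    apply syzygy_map_injective V n (homOfLE (inf_le_left : x ⊓ J ≤ x))
    rw [map_zero]
    exact nat.symm.trans ((congrArg _ hφ).trans hz)
  obtain ⟨r', hr'⟩ := exists_syzygyι_eq V (n + 1) φ hφ0
  refine ⟨r', syzygyι_injective V (n + 1) x ?_⟩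
  have nat' := ConcreteCategory.congr_hom
    ((syzygyι V (n + 1)).naturality (homOfLE (inf_le_left : x ⊓ J ≤ x))) r'
  refine nat'.trans ((congrArg _ hr').trans hφ)

/-! ### The join of all diagrams of bounded size -/

/-- The diagram of the cells `(i, j)` with `(i + 1) * (j + 1) ≤ n`. It is the join of all diagrams
with at most `n` cells. -/
def hyperbola (n : ℕ) : YoungDiagram where
  cells := (Finset.range n ×ˢ Finset.range n).filter fun c => (c.1 + 1) * (c.2 + 1) ≤ n
  isLowerSet := by
    rintro ⟨a, b⟩ ⟨c, d⟩ ⟨hc, hd⟩ h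
    simp only [Finset.coe_filter, Finset.mem_product, Finset.mem_range, Set.mem_ofPred_eq] at h ⊢
    have hc' : c ≤ a := hc
    have hd' : d ≤ b := hd
    exact ⟨⟨hc'.trans_lt h.1.1, hd'.trans_lt h.1.2⟩, le_trans (by gcongr) h.2⟩

theorem mem_hyperbola {n i j : ℕ} : (i, j) ∈ hyperbola n ↔ (i + 1) * (j + 1) ≤ n := by
  rw [← YoungDiagram.mem_cells]
  simp only [hyperbola, Finset.mem_filter, Finset.mem_product, Finset.mem_range,
    and_iff_right_iff_imp]
  exact fun h => ⟨by nlinarith, by nlinarith⟩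

/-- A diagram containing `(i, j)` contains the whole rectangle of `(i + 1) * (j + 1)` cells. -/
theorem le_hyperbola {x : YoungDiagram} {n : ℕ} (h : sumNorm x ≤ n) : x ≤ hyperbola n := by
  rintro ⟨i, j⟩ hx
  refine mem_hyperbola.2 (le_trans ?_ h)
  rw [sumNorm_eq_card, ← Finset.card_range (i + 1), ← Finset.card_range (j + 1),
    ← Finset.card_product]
  refine Finset.card_le_card ?_
  rintro ⟨a, b⟩ hab
  simp only [Finset.mem_product, Finset.mem_range, Nat.lt_succ_iff] at hab
  exact (YoungDiagram.mem_cells _).2 (x.up_left_mem hab.1 hab.2 hx)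

theorem sumNorm_mono {x y : YoungDiagram} (h : x ≤ y) : sumNorm x ≤ sumNorm y := by
  rw [sumNorm_eq_card, sumNorm_eq_card]
  exact Finset.card_le_card h

/-- The row `i` of the hyperbola has `n / (i + 1)` cells. -/
theorem sumNorm_hyperbola_le_sum (n : ℕ) :
    sumNorm (hyperbola n) ≤ ∑ i ∈ Finset.range n, n / (i + 1) := by
  rw [sumNorm_eq_card, YoungDiagram.card,
    Finset.card_eq_sum_card_fiberwise (f := Prod.fst) (t := Finset.range n)]
  · refine Finset.sum_le_sum fun i _ => ?_
    rw [← Finset.card_range (n / (i + 1))]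
    refine Finset.card_le_card_of_injOn Prod.snd ?_ ?_
    · rintro ⟨a, b⟩ hab
      obtain ⟨hm, rfl⟩ := Finset.mem_filter.1 hab
      rw [Finset.coe_range, Set.mem_Iio, ← Nat.succ_le_iff, Nat.le_div_iff_mul_le a.succ_pos,
        mul_comm]
      exact mem_hyperbola.1 ((YoungDiagram.mem_cells _).1 hm)
    · rintro ⟨a, b⟩ hab ⟨c, d⟩ hcd h
      have h1 : a = i := (Finset.mem_filter.1 hab).2
      have h2 : c = i := (Finset.mem_filter.1 hcd).2
      exact Prod.ext (h1.trans h2.symm) h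
  · intro c hc
    exact (Finset.mem_product.1 (Finset.mem_filter.1 hc).1).1

theorem sumNorm_hyperbola_le (n : ℕ) :
    (sumNorm (hyperbola n) : ℝ) ≤ n * (Real.log n + 1) := by
  calc (sumNorm (hyperbola n) : ℝ) ≤ ((∑ i ∈ Finset.range n, n / (i + 1) : ℕ) : ℝ) := by
        exact_mod_cast sumNorm_hyperbola_le_sum n
    _ ≤ ∑ i ∈ Finset.range n, (n : ℝ) * ((i : ℝ) + 1)⁻¹ := by
        rw [Nat.cast_sum]
        refine Finset.sum_le_sum fun i _ => ?_
        refine Nat.cast_div_le.trans (le_of_eq ?_)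
        rw [div_eq_mul_inv, Nat.cast_add, Nat.cast_one]
    _ = n * (harmonic n : ℝ) := by
        rw [← Finset.mul_sum, harmonic]
        push_cast
        rfl
    _ ≤ n * (Real.log n + 1) := by
        rw [add_comm]
        exact mul_le_mul_of_nonneg_left (harmonic_le_one_add_log n) n.cast_nonneg

/-! ### Homological degrees -/

theorem sumNorm_le_hd {s : ℕ} {V : YModule k} {x : YoungDiagram}
    (hx : x ∈ support (homology s V)) : (sumNorm x : EReal) ≤ hd s V := by
  rw [hd, if_neg (Set.nonempty_iff_ne_empty.1 ⟨x, hx⟩)]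
  exact le_iSup₂ (f := fun x (_ : x ∈ support (homology s V)) => (sumNorm x : EReal)) x hx

theorem hd_le_of_subset {s : ℕ} {V : YModule k} {J : YoungDiagram}
    (h : support (homology s V) ⊆ Set.Iic J) : hd s V ≤ (sumNorm J : EReal) := by
  have hJ : (0 : EReal) ≤ (sumNorm J : EReal) := by exact_mod_cast Nat.zero_le _
  rw [hd]
  split_ifs
  · exact le_trans (by simp) hJ
  · exact iSup₂_le fun x hx => Nat.cast_le.2 (sumNorm_mono (h hx))

theorem subset_hyperbola_of_hd_le {s : ℕ} {V : YModule k} {r : ℝ} (h : hd s V ≤ (r : EReal)) :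
    support (homology s V) ⊆ Set.Iic (hyperbola ⌊r⌋₊) := by
  intro x hx
  refine le_hyperbola (Nat.le_floor ?_)
  have h1 := (sumNorm_le_hd hx).trans h
  exact_mod_cast h1

/-- Only finitely many diagrams have a given size, so bounding the sizes of the diagrams in the
support amounts to bounding the diagrams themselves. -/
theorem hd_lt_top_iff {s : ℕ} {V : YModule k} :
    hd s V < ⊤ ↔ ∃ J, support (homology s V) ⊆ Set.Iic J := by
  constructor
  · intro h
    obtain ⟨r, hr, _⟩ := EReal.lt_iff_exists_real_btwn.1 h
    exact ⟨_, subset_hyperbola_of_hd_le hr.le⟩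
  · rintro ⟨J, hJ⟩
    exact (hd_le_of_subset hJ).trans_lt (EReal.coe_lt_top (sumNorm J : ℝ))

/-- A representation is presented in finite degrees if and only if it is determined by its
restriction to the diagrams contained in some fixed diagram. -/
theorem presentedInFiniteDegrees_iff {V : YModule k} :
    PresentedInFiniteDegrees k V ↔ ∃ J, determinedBelow k J V := by
  rw [PresentedInFiniteDegrees, max_lt_iff, hd_lt_top_iff, hd_lt_top_iff]
  constructor
  · rintro ⟨⟨J₀, h₀⟩, J₁, h₁⟩
    exact ⟨J₀ ⊔ J₁, determinedBelow_of_support_subset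
      (h₀.trans (Set.Iic_subset_Iic.2 le_sup_left))
      (h₁.trans (Set.Iic_subset_Iic.2 le_sup_right))⟩
  · rintro ⟨J, hJ⟩
    exact ⟨⟨J, support_homology_subset_of_determinedBelow hJ 0⟩,
      J, support_homology_subset_of_determinedBelow hJ 1⟩

theorem determinedBelow_mono {J J' : YoungDiagram} (h : J ≤ J') :
    determinedBelow k J ≤ determinedBelow k J' := fun _ hV =>
  determinedBelow_of_support_subset
    ((support_homology_subset_of_determinedBelow hV 0).trans (Set.Iic_subset_Iic.2 h))
    ((support_homology_subset_of_determinedBelow hV 1).trans (Set.Iic_subset_Iic.2 h))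

theorem hd_lt_top {V : YModule k} (h : PresentedInFiniteDegrees k V) (s : ℕ) : hd s V < ⊤ := by
  obtain ⟨J, hJ⟩ := presentedInFiniteDegrees_iff.1 h
  exact hd_lt_top_iff.2 ⟨J, support_homology_subset_of_determinedBelow hJ s⟩

/-- Positive homological degrees are at least `1`, so that their logarithm is nonnegative. -/
theorem one_le_hd_of_pos {s : ℕ} {V : YModule k} (h : 0 < hd s V) : 1 ≤ hd s V := by
  rw [hd] at h ⊢
  split_ifs at h ⊢
  · exact absurd h (by simp)
  · obtain ⟨x, hx⟩ := lt_iSup_iff.1 h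
    obtain ⟨hxs, hpos⟩ := lt_iSup_iff.1 hx
    have h1 : 1 ≤ sumNorm x := by exact_mod_cast hpos
    exact le_iSup₂_of_le x hxs (by exact_mod_cast h1)

theorem hd_add_two_le (V : YModule k) (n : ℕ) (h : 0 < hd (n + 1) V) :
    hd (n + 2) V ≤ hd (n + 1) V * (ENNReal.log (hd (n + 1) V).toENNReal + 1) := by
  have h1 := one_le_hd_of_pos h
  induction hr : hd (n + 1) V with
  | bot => simp [hr] at h
  | top =>
    have h2 : (⊤ : EReal) * (⊤ + 1) = ⊤ := by
      rw [EReal.top_add_of_ne_bot (show (1 : EReal) ≠ ⊥ from EReal.coe_ne_bot 1), EReal.top_mul_top]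
    simp [h2]
  | coe r =>
    rw [hr] at h1
    have hr1 : (1 : ℝ) ≤ r := by exact_mod_cast h1
    have hfl : (⌊r⌋₊ : ℝ) ≤ r := Nat.floor_le (by linarith)
    have hfl1 : (1 : ℝ) ≤ ⌊r⌋₊ := by exact_mod_cast Nat.le_floor (by simpa using hr1)
    have hsub := support_homology_succ_subset V n (subset_hyperbola_of_hd_le hr.le)
    have hbound : (sumNorm (hyperbola ⌊r⌋₊) : ℝ) ≤ r * (Real.log r + 1) := by
      refine (sumNorm_hyperbola_le _).trans ?_
      have := Real.log_nonneg hfl1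
      gcongr
    rw [EReal.toENNReal_of_ne_top (EReal.coe_ne_top r), EReal.toReal_coe,
      ENNReal.log_ofReal_of_pos (by linarith)]
    exact (hd_le_of_subset hsub).trans (by exact_mod_cast hbound)

/-! ### Closure properties -/

instance presentedInFiniteDegrees_isClosedUnderKernels :
    (PresentedInFiniteDegrees k).IsClosedUnderKernels where
  kernels_le := by
    rintro _ ⟨f, c, hc, hV, hW⟩
    obtain ⟨J, hJ⟩ := presentedInFiniteDegrees_iff.1 hV
    obtain ⟨J', hJ'⟩ := presentedInFiniteDegrees_iff.1 hW
    exact presentedInFiniteDegrees_iff.2 ⟨J ⊔ J', determinedBelow_of_isLimit_kernelFork hc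
      (determinedBelow_mono le_sup_left _ hJ) (determinedBelow_mono le_sup_right _ hJ')⟩

instance presentedInFiniteDegrees_isClosedUnderCokernels :
    (PresentedInFiniteDegrees k).IsClosedUnderCokernels where
  cokernels_le := by
    rintro _ ⟨f, c, hc, hV, hW⟩
    obtain ⟨J, hJ⟩ := presentedInFiniteDegrees_iff.1 hV
    obtain ⟨J', hJ'⟩ := presentedInFiniteDegrees_iff.1 hW
    exact presentedInFiniteDegrees_iff.2 ⟨J ⊔ J', determinedBelow_of_isColimit_cokernelCofork hc
      (determinedBelow_mono le_sup_left _ hJ) (determinedBelow_mono le_sup_right _ hJ')⟩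

instance presentedInFiniteDegrees_isClosedUnderFiniteProducts :
    (PresentedInFiniteDegrees k).IsClosedUnderFiniteProducts where
  isClosedUnderLimitsOfShape S _ :=
    { limitsOfShape_le := by
        rintro V ⟨p⟩
        have := Fintype.ofFinite S
        choose J hJ using fun s : S => presentedInFiniteDegrees_iff.1 (p.prop_diag_obj ⟨s⟩)
        refine presentedInFiniteDegrees_iff.2 ⟨Finset.univ.sup J,
          (determinedBelow k _).prop_of_isLimit p.isLimit fun s => ?_⟩
        exact determinedBelow_mono (Finset.le_sup (Finset.mem_univ s.as)) _ (hJ s.as) }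

instance presentedInFiniteDegrees_containsZero : (PresentedInFiniteDegrees k).ContainsZero where
  exists_zero := by
    obtain ⟨Z, h0⟩ := HasZeroObject.zero (C := YModule k)
    refine ⟨Z, h0, presentedInFiniteDegrees_iff.2 ⟨⊥, fun x => ?_⟩⟩
    have h (y : YoungDiagram) : IsZero (Z.obj y) := (Functor.isZero_iff _).1 h0 y
    exact ⟨0, (h _).eq_of_src _ _, (h _).eq_of_src _ _⟩

end YoungLattice

open YoungLattice in
theorem theorem1p3 (k : Type u) [Field k] :
    -- finiteness of all homological degrees
    (∀ V : YModule k, PresentedInFiniteDegrees k V → ∀ s : ℕ, hd s V < ⊤) ∧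
    -- the modules presented in finite degrees form an abelian subcategory of all modules
    ((PresentedInFiniteDegrees k).ContainsZero ∧
      (PresentedInFiniteDegrees k).IsClosedUnderFiniteProducts ∧
      (PresentedInFiniteDegrees k).IsClosedUnderKernels ∧
      (PresentedInFiniteDegrees k).IsClosedUnderCokernels ∧
      ∃ A : Abelian (PresentedInFiniteDegrees k).FullSubcategory,
        A.toPreadditive =
          (inferInstance : Preadditive (PresentedInFiniteDegrees k).FullSubcategory)) ∧
    -- the recursive bound, for every module
    (∀ V : YModule k, ∀ s : ℕ, 2 ≤ s → 0 < hd (s - 1) V →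
      hd s V ≤ hd (s - 1) V * (ENNReal.log (hd (s - 1) V).toENNReal + 1)) := by
  refine ⟨fun V hV s => hd_lt_top hV s,
    ⟨inferInstance, inferInstance, inferInstance, inferInstance, inferInstance, rfl⟩, ?_⟩
  intro V s hs h
  obtain ⟨n, rfl⟩ := Nat.exists_eq_add_of_le' hs
  exact hd_add_two_le V n h
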